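/- Let $M,N,P\ge 1$ and consider single-input single-output OTFS on an $N\times M$ delay-Doppler grid over a channel with $P$ paths having delays $\tau_i=\alpha_i/(M\Delta f)$ and Doppler shifts $\nu_i=\beta_i/(NT)$, where $T,\Delta f>0$, $\alpha_i,\beta_i\in\mathbb Z$ and the pairs $(\beta_i \bmod N,\ \alpha_i \bmod M)$ are pairwise distinct. For a vector $x\in\mathbb C^{MN}$, with entries $x_{k+Nl}=x[k,l]$, $0\le k<N$, $0\le l<M$, let the symbol matrix $X$ be the $P\times MN$ matrix whose entry in row $i$ and column $k+Nl$ is $x[(k-\beta_i)\bmod N,\ (l-\alpha_i)\bmod M]$. Let $\mathbb A\subset\mathbb C$ be a finite alphabet with at least two elements whose pairwise differences are algebraic numbers (for instance a QAM or PSK alphabet). Let $\Phi=\mathrm{diag}\{\phi_0^{(0)},\dots,\phi_{N-1}^{(0)},\phi_0^{(1)},\dots,\phi_{N-1}^{(M-1)}\}$ with $\phi_q^{(l)}=e^{j a_q^{(l)}}$, where the $a_q^{(l)}$ are real, pairwise distinct and algebraic. For $x\in\mathbb A^{MN}$ let $X'$ be the symbol matrix of the phase rotated transmit vector $\Phi x$.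 (i) For all $x_i\ne x_j$ in $\mathbb A^{MN}$, the difference matrix $\Delta'_{ij}=X'_i-X'_j$ has rank $P$; hence $\min_{i\neq j}\operatorname{rank}\Delta'_{ij}=P$. (ii) Phase rotated OTFS with maximum likelihood detection achieves the full diversity order $P$. Precisely, let the received vector be given by $y^T=h'X'+v^T$ with $h'_i=h_ie^{-j2\pi\nu_i\tau_i}$, where $h_1,\dots,h_P$ are i.i.d. $\mathcal{CN}(0,1/P)$, the $MN$ entries of the noise $v$ are i.i.d. $\mathcal{CN}(0,1/\gamma)$ and independent of the $h_i$, and $x$ is uniformly distributed on $\mathbb A^{MN}$ and independent of $(h,v)$. Let the detector know $h'$ and (measurably, with ties broken arbitrarily) choose some $\hat x\in\operatorname{argmin}_{x\in\mathbb A^{MN}}\|y^T-h'X'\|^2$. Then the error probability $p(\gamma)=\Pr(\hat x\ne x)$ is positive for all large $\gamma$ and satisfies $$\lim_{\gamma\to\infty}\frac{-\log p(\gamma)}{\log\gamma}=P,$$ and the same holds for the bit error rate under every injective labelling of the symbols of $\mathbb A$ by bit strings of a common length. -/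

import Mathlib

open MeasureTheory ProbabilityTheory Filter Topology
open scoped NNReal Matrix

namespace OTFS

/-- The `N × M` delay-Doppler grid. The point `(k, l)`, with Doppler index `k` and delay index `l`,
carries the entry number `k + N l` of the transmit vector; index arithmetic is modulo `N`, `M`. -/
abbrev Grid (N M : ℕ) : Type := ZMod N × ZMod M

/-- The diagonal phase rotation matrix with diagonal entries `exp (j a_q)`. -/
noncomputable def phaseMatrix {N M : ℕ} (a : Grid N M → ℝ) : Matrix (Grid N M) (Grid N M) ℂ :=
  Matrix.diagonal fun q => Complex.exp (Complex.I * (a q : ℂ))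

/-- The phase rotated transmit vector `Φ x`. -/
noncomputable def rotate {N M : ℕ} [NeZero N] [NeZero M] (a : Grid N M → ℝ) {A : Finset ℂ}
    (x : Grid N M → A) : Grid N M → ℂ :=
  phaseMatrix a *ᵥ fun q => (x q : ℂ)

/-- The `P × MN` symbol matrix of a transmit vector `x`, for `P` paths with integer delay taps
`α i` and integer Doppler taps `β i`: row `i`, column `(k, l)` holds
`x[(k - β i) mod N, (l - α i) mod M]`. -/
def symbolMatrix {N M P : ℕ} (α β : Fin P → ℤ) (x : Grid N M → ℂ) :
    Matrix (Fin P) (Grid N M) ℂ :=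
  Matrix.of fun i q => x (q.1 - (β i : ZMod N), q.2 - (α i : ZMod M))

/-- The difference of the symbol matrices of two phase rotated transmit vectors. -/
noncomputable def diffMatrix {N M P : ℕ} [NeZero N] [NeZero M] (α β : Fin P → ℤ)
    (a : Grid N M → ℝ) {A : Finset ℂ} (x₁ x₂ : Grid N M → A) : Matrix (Fin P) (Grid N M) ℂ :=
  symbolMatrix α β (rotate a x₁) - symbolMatrix α β (rotate a x₂)

/-- The circularly symmetric complex Gaussian law `CN(0, s)`: independent real and imaginary
parts, each centred of variance `s / 2`. -/
noncomputable def complexGaussian (s : ℝ≥0) : Measure ℂ :=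
  ((gaussianReal 0 (s / 2)).prod (gaussianReal 0 (s / 2))).map
    fun p : ℝ × ℝ => (p.1 : ℂ) + (p.2 : ℂ) * Complex.I

/-- Joint law of the path gains `h` (i.i.d. `CN(0, 1/P)`) and of the noise `v` (i.i.d.
`CN(0, N₀)`, `N₀ = 1/γ`), which are independent; `γ > 0` is the signal-to-noise ratio. -/
noncomputable def channelLaw (N M P : ℕ) [NeZero N] [NeZero M] (γ : ℝ) :
    Measure ((Fin P → ℂ) × (Grid N M → ℂ)) :=
  (Measure.pi fun _ : Fin P => complexGaussian ((P : ℝ≥0)⁻¹)).prod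
    (Measure.pi fun _ : Grid N M => complexGaussian (Real.toNNReal γ⁻¹))

/-- The effective gains `h'_i = h_i exp (-j 2π ν_i τ_i)`, where `τ_i = α_i / (M Δf)` and
`ν_i = β_i / (N T)`. -/
noncomputable def effectiveGain (N M : ℕ) {P : ℕ} (T Δf : ℝ) (α β : Fin P → ℤ)
    (h : Fin P → ℂ) : Fin P → ℂ := fun i =>
  h i * Complex.exp (-(Complex.I * 2 * (Real.pi : ℂ) *
    (((β i : ℝ) / (N * T) : ℝ) : ℂ) * (((α i : ℝ) / (M * Δf) : ℝ) : ℂ)))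

/-- The received vector `h' X' + v` when the phase rotated version of `x` is sent. -/
noncomputable def received {N M P : ℕ} [NeZero N] [NeZero M] (α β : Fin P → ℤ)
    (a : Grid N M → ℝ) {A : Finset ℂ} (x : Grid N M → A) (h' : Fin P → ℂ) (v : Grid N M → ℂ) :
    Grid N M → ℂ :=
  h' ᵥ* symbolMatrix α β (rotate a x) + v

/-- A maximum likelihood detector with perfect channel state information: a (measurable) rule
which, from the effective gains `h'` and the received vector `y`, selects a minimizer over all
transmit vectors `x` of the squared Euclidean distance between `y` and `h' X'`. Ties may be broken
in any way. -/
structure IsMLDetector {N M P : ℕ} [NeZero N] [NeZero M] (α β : Fin P → ℤ) (a : Grid N M → ℝ)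
    {A : Finset ℂ} (dec : (Fin P → ℂ) → (Grid N M → ℂ) → (Grid N M → A)) : Prop where
  measurable : Measurable fun p : (Fin P → ℂ) × (Grid N M → ℂ) => dec p.1 p.2
  isMin : ∀ (h' : Fin P → ℂ) (y : Grid N M → ℂ) (x : Grid N M → A),
    ∑ q, ‖y q - (h' ᵥ* symbolMatrix α β (rotate a (dec h' y))) q‖ ^ 2 ≤
      ∑ q, ‖y q - (h' ᵥ* symbolMatrix α β (rotate a x)) q‖ ^ 2

/-- The vector decided by the detector `dec` when `x` is sent and the gains and the noise are
`ω = (h, v)`. -/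
noncomputable def decision {N M P : ℕ} [NeZero N] [NeZero M] (T Δf : ℝ) (α β : Fin P → ℤ)
    (a : Grid N M → ℝ) {A : Finset ℂ} (dec : (Fin P → ℂ) → (Grid N M → ℂ) → (Grid N M → A))
    (x : Grid N M → A) (ω : (Fin P → ℂ) × (Grid N M → ℂ)) : Grid N M → A :=
  dec (effectiveGain N M T Δf α β ω.1)
    (received α β a x (effectiveGain N M T Δf α β ω.1) ω.2)

/-- Probability, at signal-to-noise ratio `γ`, that the transmit vector is decided wrongly,
averaged over channel, noise and equiprobable transmit vectors. -/
noncomputable def vectorErrorProb {N M P : ℕ} [NeZero N] [NeZero M] (T Δf : ℝ)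
    (α β : Fin P → ℤ) (a : Grid N M → ℝ) {A : Finset ℂ}
    (dec : (Fin P → ℂ) → (Grid N M → ℂ) → (Grid N M → A)) (γ : ℝ) : ℝ :=
  (∑ x : Grid N M → A, (channelLaw N M P γ).real {ω | decision T Δf α β a dec x ω ≠ x}) /
    Fintype.card (Grid N M → A)

/-- Bit error rate at signal-to-noise ratio `γ`, when the symbol `s` of the alphabet carries the
`b` bits `label s`: the probability that a bit is decided wrongly, averaged over channel, noise,
equiprobable transmit vectors and the `M N b` bits of the frame. -/
noncomputable def bitErrorRate {N M P : ℕ} [NeZero N] [NeZero M] (T Δf : ℝ)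
    (α β : Fin P → ℤ) (a : Grid N M → ℝ) {A : Finset ℂ}
    (dec : (Fin P → ℂ) → (Grid N M → ℂ) → (Grid N M → A)) {b : ℕ} (label : A → Fin b → Bool)
    (γ : ℝ) : ℝ :=
  (∑ x : Grid N M → A, ∑ q : Grid N M, ∑ t : Fin b,
      (channelLaw N M P γ).real
        {ω | label (decision T Δf α β a dec x ω q) t ≠ label (x q) t}) /
    (Fintype.card (Grid N M → A) * (M * N * b))

/-- The error rate `p`, a function of the signal-to-noise ratio, has (asymptotic) diversity order
`d`: it is positive at high signal-to-noise ratio, and `- log p(γ) / log γ → d` as `γ → ∞`. -/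
def HasDiversityOrder (p : ℝ → ℝ) (d : ℝ) : Prop :=
  (∀ᶠ γ in atTop, 0 < p γ) ∧
    Tendsto (fun γ => -Real.log (p γ) / Real.log γ) atTop (𝓝 d)

end OTFS

/-! The rows of a difference matrix are translates, on the group `ZMod N × ZMod M`, of the single
function `q ↦ exp (I * a q) * (x₁ q - x₂ q)`, by the pairwise distinct shifts `(β i, α i)`.
Translates are independent as soon as no Fourier coefficient of the function vanishes
(`linearIndependent_translates`). Here a Fourier coefficient is a combination of exponentials of the
distinct algebraic numbers `I * a q`, whose coefficients (symbol difference times root of unity) are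
algebraic and not all zero. It is nonzero by Lindemann–Weierstrass, which is proved in Baker's form
by a Galois norm argument on the group algebra `K[K]` and polynomial approximation of the
exponential.

Full rank gives `κ * ‖h‖ ≤ ‖h ᵥ* D‖` uniformly over the difference matrices `D` of distinct vectors.
A detection error then forces the gain vector to be at most a constant times the noise; since the
gains fill `P` complex dimensions with bounded density and the noise has size `γ ^ (-1/2)`, this
costs `γ ^ (-P)` (`exists_errorProb_le`). Conversely, a fixed wrong vector strictly beats the sent
one on a nonempty open cone of pairs (gain, noise), whose probability is at least of the same order
(`exists_le_errorProb`). Constants disappear in the logarithmic limit, and the bit error rate is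
within constant factors of the vector error rate. -/

namespace LindemannWeierstrass

open Polynomial AddMonoidAlgebra

/-! ### Lindemann–Weierstrass via Galois norms in the group algebra. -/

section Galois

variable {K : Type*} [Field K]

theorem isIntegral_pow_mul_aeval {d : ℤ} {x : K} (hx : IsIntegral ℤ ((d : K) * x)) (g : ℤ[X])
    {D : ℕ} (hD : g.natDegree ≤ D) : IsIntegral ℤ ((d : K) ^ D * aeval x g) := by
  rw [aeval_eq_sum_range, Finset.mul_sum]
  refine IsIntegral.sum _ fun i hi => ?_
  have hi' : i ≤ D := by have := Finset.mem_range.1 hi; omega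
  have : (d : K) ^ D * (g.coeff i • x ^ i) =
      ((d ^ (D - i) * g.coeff i : ℤ) : K) * ((d : K) * x) ^ i := by
    rw [← Nat.sub_add_cancel hi', pow_add, zsmul_eq_mul, mul_pow]
    push_cast
    simp
    ring
  rw [this]
  exact (isIntegral_algebraMap (R := ℤ) (x := d ^ (D - i) * g.coeff i)).mul (hx.pow i)

/-- The evaluation `∑ b X^x ↦ ∑ b e^x` of the group algebra `K[K]`. -/
noncomputable def evalExp [Algebra K ℂ] : AddMonoidAlgebra K K →ₐ[K] ℂ :=
  AddMonoidAlgebra.lift K ℂ K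
    { toFun := fun x => Complex.exp (algebraMap K ℂ x.toAdd)
      map_one' := by simp
      map_mul' := fun x y => by simp [Complex.exp_add] }

theorem evalExp_apply [Algebra K ℂ] (F : AddMonoidAlgebra K K) :
    evalExp F = ∑ x ∈ F.coeff.support,
      algebraMap K ℂ (F.coeff x) * Complex.exp (algebraMap K ℂ x) := by
  simp [evalExp, AddMonoidAlgebra.lift_apply, Finsupp.sum, Algebra.smul_def]

variable [Algebra ℚ K]

/-- The Galois group acting on the coefficients (through `p.1`) and on the exponents (through
`p.2`) of the group algebra `K[K]`. -/
noncomputable def conj (p : Gal(K/ℚ) × Gal(K/ℚ)) : AddMonoidAlgebra K K →+* AddMonoidAlgebra K K :=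
  (AddMonoidAlgebra.mapDomainRingHom K (p.2 : K →+ K)).comp
    (AddMonoidAlgebra.mapRingHom K (p.1 : K →+* K))

theorem conj_single (p : Gal(K/ℚ) × Gal(K/ℚ)) (x b : K) :
    conj p (single x b) = single (p.2 x) (p.1 b) := by
  simp [conj]

theorem conj_mul (p q : Gal(K/ℚ) × Gal(K/ℚ)) (F : AddMonoidAlgebra K K) :
    conj (p * q) F = conj p (conj q F) := by
  induction F using AddMonoidAlgebra.induction_linear with
  | zero => simp
  | add F G hF hG => simp only [map_add, hF, hG]
  | single x b => simp [conj_single]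

theorem conj_one (F : AddMonoidAlgebra K K) : conj 1 F = F := by
  induction F using AddMonoidAlgebra.induction_linear with
  | zero => simp
  | add F G hF hG => simp only [map_add, hF, hG]
  | single x b => simp [conj_single]

theorem conj_injective (p : Gal(K/ℚ) × Gal(K/ℚ)) : Function.Injective (conj p) :=
  Function.LeftInverse.injective (g := conj p⁻¹) fun F => by
    rw [← conj_mul, inv_mul_cancel, conj_one]

theorem coeff_conj (p : Gal(K/ℚ) × Gal(K/ℚ)) (F : AddMonoidAlgebra K K) (x : K) :
    (conj p F).coeff (p.2 x) = p.1 (F.coeff x) := by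
  classical
  induction F using AddMonoidAlgebra.induction_linear with
  | zero => simp
  | add F G hF hG => simp [hF, hG]
  | single y b => simp [conj_single, Finsupp.single_apply, apply_ite p.1]

variable [FiniteDimensional ℚ K]

theorem exists_int_mul_isIntegral (s : Finset K) :
    ∃ d : ℤ, d ≠ 0 ∧ ∀ x ∈ s, IsIntegral ℤ ((d : K) * x) := by
  have : Algebra.IsAlgebraic ℤ K := by
    have := Algebra.IsAlgebraic.of_finite ℚ K
    exact (IsFractionRing.comap_isAlgebraic_iff (A := ℤ) (K := ℚ) (C := K)).2 this
  obtain ⟨d, hd, h⟩ := Algebra.IsAlgebraic.exists_integral_multiples ℤ (A := K) s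
  exact ⟨d, hd, fun x hx => by simpa [Algebra.smul_def] using h x hx⟩

theorem exists_polynomial_aeval_eq_zero (s : Finset K) (h0 : 0 ∉ s) :
    ∃ f : ℤ[X], f.eval 0 ≠ 0 ∧ ∀ x ∈ s, aeval x f = 0 := by
  have alg : Algebra.IsAlgebraic ℤ K := by
    have := Algebra.IsAlgebraic.of_finite ℚ K
    exact (IsFractionRing.comap_isAlgebraic_iff (A := ℤ) (K := ℚ) (C := K)).2 this
  have key : ∀ x ∈ s, ∃ f : ℤ[X], f.eval 0 ≠ 0 ∧ aeval x f = 0 := by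
    intro x hx
    obtain ⟨f, h1, h2⟩ := (alg.isAlgebraic x).exists_nonzero_coeff_and_aeval_eq_zero
      (mem_nonZeroDivisors_of_ne_zero (ne_of_mem_of_not_mem hx h0))
    exact ⟨f, by simpa [coeff_zero_eq_eval_zero] using h1, h2⟩
  choose! f hf using key
  refine ⟨∏ x ∈ s, f x, ?_, fun x hx => ?_⟩
  · rw [eval_prod]
    exact Finset.prod_ne_zero_iff.2 fun x hx => (hf x hx).1
  · rw [map_prod]
    exact Finset.prod_eq_zero hx (hf x hx).2

variable [IsGalois ℚ K]

theorem exists_intCast_of_fixed {x : K} (hint : IsIntegral ℤ x)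
    (hfix : ∀ σ : Gal(K/ℚ), σ x = x) : ∃ z : ℤ, x = z := by
  obtain ⟨q, rfl⟩ := (IsGalois.mem_range_algebraMap_iff_fixed x).2 hfix
  have hq : IsIntegral ℤ q :=
    (isIntegral_algebraMap_iff (algebraMap ℚ K).injective).1 hint
  obtain ⟨z, rfl⟩ := IsIntegrallyClosed.isIntegral_iff.1 hq
  exact ⟨z, by simp⟩

/-- A nonzero integer plus an integral combination of exponentials of nonzero algebraic numbers
does not vanish, if the coefficients are constant on Galois orbits. -/
theorem add_sum_exp_ne_zero [Algebra K ℂ] (s : Finset K) (h0 : 0 ∉ s)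
    (hs : ∀ (σ : Gal(K/ℚ)), ∀ x ∈ s, σ x ∈ s) (b : K → ℤ) (hb : ∀ (σ : Gal(K/ℚ)) x, b (σ x) = b x)
    (w : ℤ) (hw : w ≠ 0) :
    (w : ℂ) + ∑ x ∈ s, (b x : ℂ) * Complex.exp (algebraMap K ℂ x) ≠ 0 := by
  intro hsum
  obtain ⟨f, hf0, hf⟩ := exists_polynomial_aeval_eq_zero s h0
  obtain ⟨d, hd, hdint⟩ := exists_int_mul_isIntegral s
  obtain ⟨c, hc⟩ := exp_polynomial_approx f hf0
  -- With these constants the final error `|d| ^ (p * deg f) * C * c ^ p / (p - 1)!` is exactly `C *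
  -- e * e ^ (p - 1) / (p - 1)!`.
  set C : ℝ := ∑ x ∈ s, |(b x : ℝ)|
  set e : ℝ := |(d : ℝ)| ^ f.natDegree * c
  have hlim : Tendsto (fun n : ℕ => C * (e * (e ^ n / n.factorial))) atTop (𝓝 0) := by
    simpa using ((FloorSemiring.tendsto_pow_div_factorial_atTop e).const_mul e).const_mul C
  obtain ⟨n₀, hn₀⟩ := eventually_atTop.1 (hlim.eventually (gt_mem_nhds one_pos))
  -- One prime serves three purposes: the error is below 1, the approximation applies (`p >
  -- |f(0)|`), and `p` divides neither `d` nor `w`.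
  obtain ⟨p, hp, prime_p⟩ := Nat.exists_infinite_primes
    (n₀ + (eval 0 f).natAbs + d.natAbs + w.natAbs + 2)
  obtain ⟨n, hn, g, hg, happ⟩ := hc p (by omega) prime_p
  have hsmall := hn₀ (p - 1) (by omega)
  -- The power of `d` makes the sum integral. It is Galois invariant because `g` has integer
  -- coefficients and `b` is constant on orbits.
  obtain ⟨S, hS⟩ : ∃ S : ℤ, (d : K) ^ (p * f.natDegree) * ∑ x ∈ s, (b x : K) * aeval x g = S := by
    refine exists_intCast_of_fixed ?_ fun σ => ?_
    · rw [Finset.mul_sum]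
      refine IsIntegral.sum _ fun x hx => ?_
      rw [mul_left_comm]
      exact (isIntegral_algebraMap (R := ℤ) (x := b x)).mul
        (isIntegral_pow_mul_aeval (hdint x hx) g (hg.trans (Nat.sub_le _ _)))
    · simp only [map_mul, map_pow, map_sum, map_intCast]
      congr 1
      refine Finset.sum_nbij (fun x => σ x) (fun x hx => hs σ x hx) (σ.injective.injOn)
        (fun x hx => ⟨σ.symm x, hs σ.symm x hx, by simp⟩) fun x hx => ?_
      rw [hb]
      congr 1
      exact (aeval_algHom_apply (σ.toAlgHom.restrictScalars ℤ) x g).symm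
  have hSC : (S : ℂ) = (d : ℂ) ^ (p * f.natDegree) *
      ∑ x ∈ s, (b x : ℂ) * aeval (algebraMap K ℂ x) g := by
    have := congrArg (algebraMap K ℂ) hS
    simp only [map_mul, map_pow, map_sum, map_intCast] at this
    rw [← this]
    congr 1
    exact Finset.sum_congr rfl fun x _ => by rw [aeval_algebraMap_apply]
  -- Modulo `p` only the first term survives, and `p` divides none of its factors.
  have hne : d ^ (p * f.natDegree) * n * w + p * S ≠ 0 := by
    intro h
    have hdvd : (p : ℤ) ∣ d ^ (p * f.natDegree) * n * w :=
      (Int.dvd_add_left (dvd_mul_right _ _)).1 (h ▸ dvd_zero _)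
    have hpp : Prime (p : ℤ) := Nat.prime_iff_prime_int.1 prime_p
    have small : ∀ z : ℤ, z ≠ 0 → z.natAbs < p → ¬ (p : ℤ) ∣ z := fun z hz hlt h =>
      absurd (Nat.le_of_dvd (Int.natAbs_pos.2 hz) (Int.natCast_dvd.1 h)) (by omega)
    rcases hpp.dvd_or_dvd hdvd with h | h
    · rcases hpp.dvd_or_dvd h with h | h
      · exact small d hd (by omega) (hpp.dvd_of_dvd_pow h)
      · exact hn h
    · exact small w hw (by omega) h
  have hone : (1 : ℝ) ≤ ‖((d ^ (p * f.natDegree) * n * w + p * S : ℤ) : ℂ)‖ := by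
    rw [Complex.norm_intCast]
    exact_mod_cast Int.one_le_abs hne
  -- Eliminating `w` by the supposed relation leaves only approximation errors, so this nonzero
  -- integer has absolute value below 1.
  have hid : ((d ^ (p * f.natDegree) * n * w + p * S : ℤ) : ℂ) =
      -((d : ℂ) ^ (p * f.natDegree) * ∑ x ∈ s, (b x : ℂ) *
        (n • Complex.exp (algebraMap K ℂ x) - p • aeval (algebraMap K ℂ x) g)) := by
    have h1 : (w : ℂ) = - ∑ x ∈ s, (b x : ℂ) * Complex.exp (algebraMap K ℂ x) :=
      eq_neg_of_add_eq_zero_left hsum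
    push_cast
    rw [hSC, h1]
    simp only [zsmul_eq_mul, nsmul_eq_mul, mul_sub, Finset.sum_sub_distrib, mul_left_comm (b _ : ℂ),
      ← Finset.mul_sum]
    ring
  rw [hid, norm_neg, norm_mul, norm_pow, Complex.norm_intCast] at hone
  have hbound : ‖∑ x ∈ s, (b x : ℂ) *
      (n • Complex.exp (algebraMap K ℂ x) - p • aeval (algebraMap K ℂ x) g)‖ ≤
      C * (c ^ p / (p - 1).factorial) := by
    rw [Finset.sum_mul]
    refine norm_sum_le_of_le _ fun x hx => ?_
    rw [norm_mul, Complex.norm_intCast]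
    refine mul_le_mul_of_nonneg_left (happ ?_) (abs_nonneg _)
    rw [mem_aroots]
    refine ⟨fun h => hf0 (by simp [h]), ?_⟩
    rw [aeval_algebraMap_apply, hf x hx, map_zero]
  have := hone.trans (mul_le_mul_of_nonneg_left hbound (by positivity))
  have heq : |(d : ℝ)| ^ (p * f.natDegree) * (C * (c ^ p / (p - 1).factorial)) =
      C * (e * (e ^ (p - 1) / (p - 1).factorial)) := by
    rw [← mul_div_assoc e, ← pow_succ', Nat.sub_add_cancel prime_p.one_le, mul_pow, ← pow_mul,
      mul_comm p]
    ring
  linarith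

variable [Algebra K ℂ]

/-- Invariance under the action on coefficients makes them rational; invariance under the action on
exponents makes them constant on orbits. Clearing denominators reduces to `add_sum_exp_ne_zero`. -/
theorem evalExp_ne_zero_of_fixed (F : AddMonoidAlgebra K K) (h0 : F.coeff 0 ≠ 0)
    (hF : ∀ p, conj p F = F) : evalExp F ≠ 0 := by
  classical
  have hfix : ∀ (σ τ : Gal(K/ℚ)) x, F.coeff (τ x) = σ (F.coeff x) := fun σ τ x => by
    rw [← coeff_conj (σ, τ), hF]
  obtain ⟨d, hd, hdint⟩ := exists_int_mul_isIntegral (F.coeff.support.image F.coeff)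
  have hint : ∀ x, ∃ z : ℤ, (d : K) * F.coeff x = z := fun x => by
    refine exists_intCast_of_fixed ?_ fun σ => ?_
    · by_cases hx : F.coeff x = 0
      · simp [hx, isIntegral_zero]
      · exact hdint _ (Finset.mem_image_of_mem _ (by simpa using hx))
    · rw [map_mul, map_intCast, ← hfix σ 1]
      rfl
  choose b hb using hint
  have hK : CharZero K := algebraRat.charZero K
  have hdK : (d : K) ≠ 0 := Int.cast_ne_zero.2 hd
  intro hE
  refine add_sum_exp_ne_zero (F.coeff.support.erase 0) (by simp) (fun σ x hx => ?_) b
    (fun σ x => ?_) (b 0) (fun h => ?_) ?_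
  · have := hfix 1 σ x
    simp_all
  · have := hb (σ x)
    rw [hfix 1 σ, AlgEquiv.one_apply, hb] at this
    exact_mod_cast this.symm
  · have := hb 0
    rw [h, Int.cast_zero] at this
    exact mul_ne_zero hdK h0 this
  · have hbC : ∀ x, (b x : ℂ) = d * algebraMap K ℂ (F.coeff x) := fun x => by
      simpa using congrArg (algebraMap K ℂ) (hb x).symm
    rw [evalExp_apply, ← Finset.add_sum_erase _ _ (by simpa using h0 : (0 : K) ∈ _)] at hE
    simp only [hbC, mul_assoc, ← Finset.mul_sum, ← mul_add]
    simpa using Or.inr hE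

/-- The product of all conjugates of a nonzero kernel element is invariant. It is nonzero because
`K[K]` has no zero divisors, and stays in the kernel because one factor is the element itself. -/
theorem evalExp_injective : Function.Injective (evalExp : AddMonoidAlgebra K K → ℂ) := by
  classical
  rw [injective_iff_map_eq_zero]
  intro F hF
  by_contra hF0
  have hprod : ∀ q, conj q (∏ p, conj p F) = ∏ p, conj p F := fun q => by
    rw [map_prod]
    exact Fintype.prod_equiv (Equiv.mulLeft q) _ _ fun p => (conj_mul q p F).symm
  have hne : ∏ p, conj p F ≠ 0 := Finset.prod_ne_zero_iff.2 fun p _ =>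
    (map_ne_zero_iff _ (conj_injective p)).2 hF0
  have heval : evalExp (∏ p, conj p F) = 0 := by
    rw [map_prod]
    exact Finset.prod_eq_zero (Finset.mem_univ 1) (by rw [conj_one, hF])
  generalize (∏ p, conj p F) = H at hprod hne heval
  obtain ⟨y, hy⟩ : ∃ y, H.coeff y ≠ 0 := by
    by_contra! h
    exact hne (AddMonoidAlgebra.ext (by ext; simp [h]))
  -- This invariant multiplier creates a nonzero constant term: each `τ` contributes `H.coeff (τ y)
  -- = H.coeff y`, so the total is the group order times `H.coeff y`.
  refine evalExp_ne_zero_of_fixed (H * ∑ τ : Gal(K/ℚ), single (-τ y) 1) ?_ (fun q => ?_)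
    (by rw [map_mul, heval, zero_mul])
  · have : ∀ τ : Gal(K/ℚ), (H * single (-τ y) 1).coeff 0 = H.coeff y := fun τ => by
      have h := coeff_conj (1, τ) H y
      rw [hprod, AlgEquiv.one_apply] at h
      rw [AddMonoidAlgebra.coeff_mul_single_eq_coeff_mul (m₂ := τ y) (by
        intro z _
        rw [add_neg_eq_zero]), mul_one, h]
    rw [Finset.mul_sum, AddMonoidAlgebra.coeff_sum, Finsupp.finsetSum_apply,
      Finset.sum_congr rfl fun τ _ => this τ]
    have hK : CharZero K := algebraRat.charZero K
    simp [hy, Fintype.card_ne_zero]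
  · rw [map_mul, hprod, map_sum]
    congr 1
    refine Fintype.sum_equiv (Equiv.mulLeft q.2) _ _ fun τ => ?_
    simp [conj_single]

end Galois

/-- The **Lindemann–Weierstrass theorem** in Baker's form: the exponentials of pairwise distinct
algebraic numbers are linearly independent over the algebraic numbers. -/
theorem eq_zero_of_sum_mul_exp_eq_zero {ι : Type*} [Fintype ι] (a b : ι → ℂ)
    (ha : ∀ i, IsAlgebraic ℚ (a i)) (hb : ∀ i, IsAlgebraic ℚ (b i)) (hinj : Function.Injective a)
    (hsum : ∑ i, b i * Complex.exp (a i) = 0) : ∀ i, b i = 0 := by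
  classical
  -- The splitting field of `f` is one finite Galois extension containing all exponents and
  -- coefficients.
  let f : ℚ[X] := ∏ i, (minpoly ℚ (a i) * minpoly ℚ (b i))
  have hf0 : f ≠ 0 := Finset.prod_ne_zero_iff.2 fun i _ =>
    mul_ne_zero (minpoly.ne_zero (ha i).isIntegral) (minpoly.ne_zero (hb i).isIntegral)
  let K := IntermediateField.adjoin ℚ (f.rootSet ℂ)
  have : f.IsSplittingField ℚ K :=
    IntermediateField.adjoin_rootSet_isSplittingField (IsAlgClosed.splits _)
  have : FiniteDimensional ℚ K := Polynomial.IsSplittingField.finiteDimensional K f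
  have : Normal ℚ K := Normal.of_isSplittingField f
  have : IsGalois ℚ K := {}
  have hmem : ∀ x : ℂ, aeval x f = 0 → ∃ y : K, (y : ℂ) = x := fun x hx =>
    ⟨⟨x, IntermediateField.subset_adjoin _ _ (by simp [mem_rootSet, hf0, hx])⟩, rfl⟩
  choose a' ha' using fun i => hmem (a i) (by
    rw [map_prod]
    exact Finset.prod_eq_zero (Finset.mem_univ i) (by simp))
  choose b' hb' using fun i => hmem (b i) (by
    rw [map_prod]
    exact Finset.prod_eq_zero (Finset.mem_univ i) (by simp))
  have hinj' : Function.Injective a' := fun i j h => hinj (by rw [← ha', ← ha', h])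
  have hF : ∑ i, single (a' i) (b' i) = (0 : AddMonoidAlgebra K K) := by
    apply evalExp_injective
    rw [map_zero, map_sum, ← hsum]
    refine Finset.sum_congr rfl fun i _ => ?_
    rw [← ha', ← hb']
    simp [evalExp, Algebra.smul_def]
  intro i
  have := congrArg (fun F => F.coeff (a' i)) hF
  simp [AddMonoidAlgebra.coeff_sum, Finsupp.single_apply, hinj'.eq_iff] at this
  rw [← hb', this]
  rfl

end LindemannWeierstrass

/-! ### Translates and characters on a finite abelian group. -/

section Translates

variable {G : Type*} [AddCommGroup G] [Fintype G]

/-- Orthogonality of characters: weighting by `χ (-s j)` and summing over `χ` isolates `c j`. -/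
theorem AddChar.eq_zero_of_sum_mul_eq_zero {ι : Type*} [Fintype ι] (s : ι → G)
    (hs : Function.Injective s) (c : ι → ℂ) (h : ∀ χ : AddChar G ℂ, ∑ i, c i * χ (s i) = 0) :
    c = 0 := by
  classical
  funext j
  have h1 : ∑ χ : AddChar G ℂ, χ (-s j) * ∑ i, c i * χ (s i) = Fintype.card G * c j := by
    simp only [Finset.mul_sum]
    rw [Finset.sum_comm]
    have : ∀ i, ∑ χ : AddChar G ℂ, χ (-s j) * (c i * χ (s i)) =
        if i = j then Fintype.card G * c i else 0 := fun i => by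
      have := AddChar.sum_apply_eq_ite (s i - s j)
      simp only [sub_eq_zero, hs.eq_iff] at this
      rw [show (if i = j then (Fintype.card G : ℂ) * c i else 0) =
        c i * if i = j then (Fintype.card G : ℂ) else 0 by split_ifs <;> ring, ← this,
        Finset.mul_sum]
      refine Finset.sum_congr rfl fun χ _ => ?_
      rw [sub_eq_add_neg, AddChar.map_add_eq_mul]
      ring
    simp [this]
  simp only [h, mul_zero, Finset.sum_const_zero] at h1
  simpa [Fintype.card_ne_zero] using h1.symm

theorem AddChar.isAlgebraic_apply (χ : AddChar G ℂ) (q : G) : IsAlgebraic ℚ (χ q) := by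
  have h : χ q ^ Fintype.card G = 1 := by
    rw [← AddChar.map_nsmul_eq_pow, card_nsmul_eq_zero, AddChar.map_zero_eq_one]
  exact (IsIntegral.of_pow Fintype.card_pos (by rw [h]; exact isIntegral_one)).isAlgebraic

/-- If all Fourier coefficients of a function on a finite abelian group are nonzero, then its
translates are linearly independent. -/
theorem linearIndependent_translates {ι : Type*} [Fintype ι] (s : ι → G)
    (hs : Function.Injective s) (d : G → ℂ) (hd : ∀ χ : AddChar G ℂ, ∑ q, d q * χ q ≠ 0) :
    LinearIndependent ℂ fun i q => d (q - s i) := by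
  rw [Fintype.linearIndependent_iff]
  intro c hc
  refine congrFun (AddChar.eq_zero_of_sum_mul_eq_zero s hs c fun χ => ?_)
  -- Translation by `s i` multiplies the Fourier coefficient at `χ` by `χ (s i)`, so that of the
  -- vanishing combination factors as this product.
  refine (mul_eq_zero.1 ?_).resolve_right (hd χ)
  have h1 : ∑ q, (∑ i, c i * d (q - s i)) * χ q = 0 := by
    refine Finset.sum_eq_zero fun q _ => ?_
    have := congrFun hc q
    simp only [Finset.sum_apply, Pi.smul_apply, smul_eq_mul, Pi.zero_apply] at this
    rw [this, zero_mul]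
  simp only [Finset.sum_mul] at h1 ⊢
  rw [Finset.sum_comm] at h1
  rw [← h1]
  refine Finset.sum_congr rfl fun i _ => ?_
  rw [Finset.mul_sum]
  refine Fintype.sum_equiv (Equiv.addRight (s i)) _ _ fun q => ?_
  simp only [Equiv.coe_addRight, add_sub_cancel_right, AddChar.map_add_eq_mul]
  ring

theorem sum_mul_exp_mul_addChar_ne_zero (a : G → ℝ) (ha_inj : Function.Injective a)
    (ha_alg : ∀ q, IsAlgebraic ℚ (a q)) (δ : G → ℂ) (hδ : ∀ q, IsAlgebraic ℚ (δ q)) (hne : δ ≠ 0)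
    (χ : AddChar G ℂ) : ∑ q, Complex.exp (Complex.I * a q) * δ q * χ q ≠ 0 := by
  intro h
  obtain ⟨q, hq⟩ := Function.ne_iff.1 hne
  have h0 := LindemannWeierstrass.eq_zero_of_sum_mul_exp_eq_zero (fun q => Complex.I * (a q : ℂ))
    (fun q => δ q * χ q) (fun q => ?_) (fun q => (hδ q).mul (χ.isAlgebraic_apply q))
    (fun p q h => ha_inj (by simpa using h)) ?_ q
  · rcases mul_eq_zero.1 h0 with h0 | h0
    · exact hq h0
    · exact (χ.val_isUnit q).ne_zero h0
  · exact Complex.isIntegral_rat_I.isAlgebraic.mul ((ha_alg q).algebraMap (A := ℂ))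
  · rw [← h]
    exact Finset.sum_congr rfl fun q _ => by ring

end Translates

/-! ### Full rank of the difference matrices. -/

namespace OTFS

variable {N M P : ℕ} [NeZero N] [NeZero M]

theorem rotate_apply (a : Grid N M → ℝ) {A : Finset ℂ} (x : Grid N M → A) (q : Grid N M) :
    rotate a x q = Complex.exp (Complex.I * a q) * x q := by
  simp [rotate, phaseMatrix, Matrix.mulVec_diagonal]

theorem linearIndependent_diffMatrix (α β : Fin P → ℤ)
    (hpaths : Function.Injective fun i => ((β i : ZMod N), (α i : ZMod M)))
    (A : Finset ℂ) (hAalg : ∀ s ∈ A, ∀ s' ∈ A, IsAlgebraic ℚ (s - s'))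
    (a : Grid N M → ℝ) (ha_inj : Function.Injective a) (ha_alg : ∀ q, IsAlgebraic ℚ (a q))
    (x₁ x₂ : Grid N M → A) (hx : x₁ ≠ x₂) :
    LinearIndependent ℂ (diffMatrix α β a x₁ x₂).row := by
  refine linearIndependent_translates (G := Grid N M) (fun i => ((β i : ZMod N), (α i : ZMod M)))
    hpaths (fun q => rotate a x₁ q - rotate a x₂ q) fun χ => ?_
  simp only [rotate_apply, ← mul_sub]
  refine sum_mul_exp_mul_addChar_ne_zero a ha_inj ha_alg (fun q => (x₁ q : ℂ) - x₂ q)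
    (fun q => hAalg _ (x₁ q).2 _ (x₂ q).2) (fun h => hx (funext fun q => Subtype.ext ?_)) χ
  exact sub_eq_zero.1 (congrFun h q)

theorem rank_diffMatrix (α β : Fin P → ℤ)
    (hpaths : Function.Injective fun i => ((β i : ZMod N), (α i : ZMod M)))
    (A : Finset ℂ) (hAalg : ∀ s ∈ A, ∀ s' ∈ A, IsAlgebraic ℚ (s - s'))
    (a : Grid N M → ℝ) (ha_inj : Function.Injective a) (ha_alg : ∀ q, IsAlgebraic ℚ (a q))
    (x₁ x₂ : Grid N M → A) (hx : x₁ ≠ x₂) : (diffMatrix α β a x₁ x₂).rank = P := by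
  rw [(linearIndependent_diffMatrix α β hpaths A hAalg a ha_inj ha_alg x₁ x₂ hx).rank_matrix,
    Fintype.card_fin]

/-- A full-rank difference matrix is bounded below as a linear map on path gains. -/
theorem exists_norm_le_norm_vecMul {D : Matrix (Fin P) (Grid N M) ℂ}
    (hD : LinearIndependent ℂ D.row) : ∃ κ : ℝ, 0 < κ ∧ ∀ h, κ * ‖h‖ ≤ ‖h ᵥ* D‖ := by
  have hinj : Function.Injective D.vecMulLinear := Matrix.vecMul_injective_iff.2 hD
  obtain ⟨K, hK, hanti⟩ := D.vecMulLinear.exists_antilipschitzWith (LinearMap.ker_eq_bot.2 hinj)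
  refine ⟨(K : ℝ)⁻¹, by positivity, fun h => ?_⟩
  have := hanti.le_mul_dist h 0
  simp only [map_zero, dist_zero_right] at this
  rw [inv_mul_le_iff₀ (by positivity)]
  exact this

end OTFS

/-! ### Gaussian mass of small balls, scaling and moments. -/

theorem gaussianReal_Icc_le {v : ℝ≥0} (hv : v ≠ 0) :
    ∃ C : ℝ, 0 ≤ C ∧ ∀ r, 0 ≤ r →
      gaussianReal 0 v (Set.Icc (-r) r) ≤ ENNReal.ofReal (C * r) := by
  refine ⟨(√(2 * Real.pi * v))⁻¹ * 2, by positivity, fun r hr => ?_⟩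
  rw [gaussianReal_apply 0 hv]
  calc ∫⁻ x in Set.Icc (-r) r, gaussianPDF 0 v x
      ≤ ∫⁻ _ in Set.Icc (-r) r, ENNReal.ofReal (√(2 * Real.pi * v))⁻¹ := by
        refine lintegral_mono fun x => ENNReal.ofReal_le_ofReal ?_
        rw [gaussianPDFReal]
        refine mul_le_of_le_one_right (by positivity) (Real.exp_le_one_iff.2 ?_)
        rw [neg_div]
        exact neg_nonpos.2 (by positivity)
    _ = _ := by
        rw [setLIntegral_const, Real.volume_Icc, ← ENNReal.ofReal_mul (by positivity)]
        congr 1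
        ring

/-- For `r ≤ 1` the interval stays within distance `|m| + ε` of the origin, where the density is at
least its value at `|m| + ε`. -/
theorem le_gaussianReal_Ioo {v : ℝ≥0} (hv : v ≠ 0) (m : ℝ) {ε : ℝ} (hε : 0 < ε) :
    ∃ c : ℝ, 0 < c ∧ ∀ r, 0 < r → r ≤ 1 →
      ENNReal.ofReal (c * r) ≤ gaussianReal 0 v (Set.Ioo (r * m - r * ε) (r * m + r * ε)) := by
  refine ⟨gaussianPDFReal 0 v (|m| + ε) * (2 * ε),
    mul_pos (gaussianPDFReal_pos _ _ _ hv) (by positivity), fun r hr hr1 => ?_⟩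
  rw [gaussianReal_apply 0 hv]
  calc _ = ∫⁻ _ in Set.Ioo (r * m - r * ε) (r * m + r * ε), gaussianPDF 0 v (|m| + ε) := by
        rw [setLIntegral_const, Real.volume_Ioo, gaussianPDF,
          ← ENNReal.ofReal_mul (gaussianPDFReal_nonneg _ _ _)]
        congr 1
        ring
    _ ≤ _ := by
        refine setLIntegral_mono' measurableSet_Ioo fun x hx => ENNReal.ofReal_le_ofReal ?_
        have hx' : |x| ≤ |m| + ε := by
          have h1 : |r * m| ≤ |m| := by
            rw [abs_mul, abs_of_pos hr]
            exact mul_le_of_le_one_left (abs_nonneg _) hr1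
          have h2 : r * ε ≤ ε := mul_le_of_le_one_left hε.le hr1
          rw [abs_le] at h1 ⊢
          constructor <;> linarith [hx.1, hx.2]
        have hsq : x ^ 2 ≤ (|m| + ε) ^ 2 := sq_le_sq' (abs_le.1 hx').1 (abs_le.1 hx').2
        simp only [gaussianPDFReal, sub_zero]
        gcongr

namespace OTFS

theorem measurable_re_add_im :
    Measurable fun p : ℝ × ℝ => (p.1 : ℂ) + (p.2 : ℂ) * Complex.I := by fun_prop

instance (s : ℝ≥0) : IsProbabilityMeasure (complexGaussian s) :=
  Measure.isProbabilityMeasure_map measurable_re_add_im.aemeasurable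

instance (N M P : ℕ) [NeZero N] [NeZero M] (γ : ℝ) : IsProbabilityMeasure (channelLaw N M P γ) := by
  unfold channelLaw
  infer_instance

theorem complexGaussian_reProdIm (s : ℝ≥0) {I J : Set ℝ} (hI : MeasurableSet I)
    (hJ : MeasurableSet J) :
    complexGaussian s (I ×ℂ J) = gaussianReal 0 (s / 2) I * gaussianReal 0 (s / 2) J := by
  have h : MeasurableSet (I ×ℂ J) := (Complex.measurable_re hI).inter (Complex.measurable_im hJ)
  rw [complexGaussian, Measure.map_apply measurable_re_add_im h, ← Measure.prod_prod]
  congr 1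
  ext p
  simp [Complex.mem_reProdIm]

theorem complexGaussian_closedBall_le {s : ℝ≥0} (hs : s ≠ 0) :
    ∃ C : ℝ, 0 ≤ C ∧ ∀ r, 0 ≤ r →
      complexGaussian s (Metric.closedBall 0 r) ≤ ENNReal.ofReal (C * r) ^ 2 := by
  obtain ⟨C, hC, h⟩ := gaussianReal_Icc_le (div_ne_zero hs two_ne_zero)
  refine ⟨C, hC, fun r hr => ?_⟩
  calc complexGaussian s (Metric.closedBall 0 r)
      ≤ complexGaussian s (Set.Icc (-r) r ×ℂ Set.Icc (-r) r) := by
        refine measure_mono fun z hz => ?_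
        rw [mem_closedBall_zero_iff] at hz
        exact ⟨abs_le.1 ((Complex.abs_re_le_norm z).trans hz),
          abs_le.1 ((Complex.abs_im_le_norm z).trans hz)⟩
    _ ≤ _ := by
        rw [complexGaussian_reProdIm s measurableSet_Icc measurableSet_Icc, sq]
        exact mul_le_mul' (h r hr) (h r hr)

theorem le_complexGaussian_ball {s : ℝ≥0} (hs : s ≠ 0) (z : ℂ) {ε : ℝ} (hε : 0 < ε) :
    ∃ c : ℝ, 0 < c ∧ ∀ r : ℝ, 0 < r → r ≤ 1 →
      ENNReal.ofReal (c * r ^ 2) ≤ complexGaussian s (Metric.ball (r • z) (r * ε)) := by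
  have hs2 : s / 2 ≠ 0 := div_ne_zero hs two_ne_zero
  -- Half of `ε` for each part, as the norm is bounded by the sum of the absolute values of the two
  -- parts.
  obtain ⟨c₁, hc₁, h₁⟩ := le_gaussianReal_Ioo hs2 z.re (half_pos hε)
  obtain ⟨c₂, hc₂, h₂⟩ := le_gaussianReal_Ioo hs2 z.im (half_pos hε)
  refine ⟨c₁ * c₂, mul_pos hc₁ hc₂, fun r hr hr1 => ?_⟩
  calc ENNReal.ofReal (c₁ * c₂ * r ^ 2)
      = ENNReal.ofReal (c₁ * r) * ENNReal.ofReal (c₂ * r) := by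
        rw [← ENNReal.ofReal_mul (by positivity)]
        congr 1
        ring
    _ ≤ _ := mul_le_mul' (h₁ r hr hr1) (h₂ r hr hr1)
    _ = _ := (complexGaussian_reProdIm s measurableSet_Ioo measurableSet_Ioo).symm
    _ ≤ _ := by
        refine measure_mono fun w hw => ?_
        have h1 : |w.re - r * z.re| < r * (ε / 2) :=
          abs_sub_lt_iff.2 ⟨by linarith [hw.1.2], by linarith [hw.1.1]⟩
        have h2 : |w.im - r * z.im| < r * (ε / 2) :=
          abs_sub_lt_iff.2 ⟨by linarith [hw.2.2], by linarith [hw.2.1]⟩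
        rw [Metric.mem_ball, dist_eq_norm, Complex.real_smul]
        have h3 := Complex.norm_le_abs_re_add_abs_im (w - r * z)
        simp only [Complex.sub_re, Complex.sub_im, Complex.re_ofReal_mul,
          Complex.im_ofReal_mul] at h3
        linarith

theorem map_smul_complexGaussian (r : ℝ) (s : ℝ≥0) :
    (complexGaussian s).map (fun z => r • z) = complexGaussian (Real.toNNReal (r ^ 2) * s) := by
  have hr : Real.toNNReal (r ^ 2) * s / 2 = Real.toNNReal (r ^ 2) * (s / 2) := mul_div_assoc _ _ _
  have hm : Measurable fun x : ℝ => r * x := measurable_const_mul r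
  have hg : gaussianReal 0 (Real.toNNReal (r ^ 2) * (s / 2)) =
      (gaussianReal 0 (s / 2)).map (fun x => r * x) := by
    rw [gaussianReal_map_const_mul, mul_zero]
    congr 1
    ext
    simp [Real.coe_toNNReal _ (sq_nonneg r)]
  rw [complexGaussian, complexGaussian, hr, hg, Measure.map_prod_map _ _ hm hm,
    Measure.map_map (by fun_prop) measurable_re_add_im,
    Measure.map_map measurable_re_add_im (by fun_prop)]
  congr 1
  funext p
  simp
  ring

theorem lintegral_norm_pow_complexGaussian_lt_top (s : ℝ≥0) (k : ℕ) :
    ∫⁻ z, ‖z‖ₑ ^ k ∂complexGaussian s < ⊤ := by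
  have hre : ∀ f : ℝ × ℝ → ℝ, MeasurePreserving f
      ((gaussianReal 0 (s / 2)).prod (gaussianReal 0 (s / 2))) (gaussianReal 0 (s / 2)) →
      MemLp (fun p => (f p : ℂ)) k
        ((gaussianReal 0 (s / 2)).prod (gaussianReal 0 (s / 2))) := fun f hf =>
    ((memLp_id_gaussianReal (μ := 0) (v := s / 2) k).comp_measurePreserving hf).ofReal
  have hmem : MemLp id k (complexGaussian s) := by
    rw [complexGaussian, memLp_map_measure_iff (by fun_prop) (by fun_prop)]
    exact (hre _ measurePreserving_fst).add
      ((hre _ measurePreserving_snd).mul_const Complex.I)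
  rcases eq_or_ne k 0 with rfl | hk
  · simp
  · have := lintegral_rpow_enorm_lt_top_of_eLpNorm_lt_top (by exact_mod_cast hk)
      (ENNReal.natCast_ne_top k) hmem.2
    simpa using this

theorem lintegral_norm_pow_complexGaussian_sq (r : ℝ) (k : ℕ) :
    ∫⁻ z, ‖z‖ₑ ^ k ∂complexGaussian (Real.toNNReal (r ^ 2)) =
      ‖r‖ₑ ^ k * ∫⁻ z, ‖z‖ₑ ^ k ∂complexGaussian 1 := by
  have h := map_smul_complexGaussian r 1
  rw [mul_one] at h
  rw [← h, lintegral_map (by fun_prop) (by fun_prop), ← lintegral_const_mul _ (by fun_prop)]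
  simp only [enorm_smul, mul_pow]

theorem pi_complexGaussian_closedBall_le (P : ℕ) {s : ℝ≥0} (hs : s ≠ 0) :
    ∃ C : ℝ, 0 ≤ C ∧ ∀ r, 0 ≤ r → (Measure.pi fun _ : Fin P => complexGaussian s)
      (Metric.closedBall 0 r) ≤ ENNReal.ofReal (C * r) ^ (2 * P) := by
  obtain ⟨C, hC, h⟩ := complexGaussian_closedBall_le hs
  refine ⟨C, hC, fun r hr => ?_⟩
  rw [Measure.pi_closedBall _ _ hr, pow_mul]
  exact (Finset.prod_le_prod' fun i _ => h r hr).trans (by simp)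

theorem le_pi_complexGaussian_ball {P : ℕ} {s : ℝ≥0} (hs : s ≠ 0) (h₀ : Fin P → ℂ) {ε : ℝ}
    (hε : 0 < ε) : ∃ c : ℝ, 0 < c ∧ ∀ r : ℝ, 0 < r → r ≤ 1 → ENNReal.ofReal (c * r ^ (2 * P)) ≤
      (Measure.pi fun _ : Fin P => complexGaussian s) (Metric.ball (r • h₀) (r * ε)) := by
  choose c hc h using fun i => le_complexGaussian_ball hs (h₀ i) hε
  refine ⟨∏ i, c i, Finset.prod_pos fun i _ => hc i, fun r hr hr1 => ?_⟩
  rw [Measure.pi_ball _ _ (by positivity)]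
  refine le_trans (le_of_eq ?_) (Finset.prod_le_prod' fun i _ => h i r hr hr1)
  rw [← ENNReal.ofReal_prod_of_nonneg fun i _ => mul_nonneg (hc i).le (sq_nonneg r),
    Finset.prod_mul_distrib]
  simp [pow_mul]

/-- The noise has the same scale `r` as the ball, so rescaling to unit variance gives a bound
independent of `r`. -/
theorem le_pi_complexGaussian_sq_ball {ι : Type*} [Fintype ι] (w : ι → ℂ) {ε : ℝ} (hε : 0 < ε) :
    ∃ c : ℝ, 0 < c ∧ ∀ r : ℝ, 0 < r → ENNReal.ofReal c ≤
      (Measure.pi fun _ : ι => complexGaussian (Real.toNNReal (r ^ 2)))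
        (Metric.ball (r • w) (r * ε)) := by
  choose c hc h using fun i => le_complexGaussian_ball one_ne_zero (w i) hε
  refine ⟨∏ i, c i, Finset.prod_pos fun i _ => hc i, fun r hr => ?_⟩
  rw [Measure.pi_ball _ _ (by positivity), ENNReal.ofReal_prod_of_nonneg fun i _ => (hc i).le]
  refine Finset.prod_le_prod' fun i _ => ?_
  have hmap := map_smul_complexGaussian r 1
  rw [mul_one] at hmap
  rw [← hmap, Measure.map_apply (by fun_prop) measurableSet_ball]
  refine le_trans (by simpa using h i 1 one_pos le_rfl) (measure_mono fun z hz => ?_)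
  rw [Metric.mem_ball] at hz
  rw [Set.mem_preimage, Metric.mem_ball, Pi.smul_apply, dist_smul₀, Real.norm_of_nonneg hr.le]
  exact mul_lt_mul_of_pos_left hz hr

end OTFS

/-! ### Euclidean distances against the sup norm. -/

/-- The norm on `ι → ℂ` is the sup norm. Comparison with the Euclidean norm costs the square root of
the cardinality, bounded here by the cardinality; the triangle inequality adds the 1. -/
theorem norm_le_of_sum_norm_add_sq_le {ι : Type*} [Fintype ι] {u v : ι → ℂ}
    (h : ∑ q, ‖u q + v q‖ ^ 2 ≤ ∑ q, ‖v q‖ ^ 2) : ‖u‖ ≤ (Fintype.card ι + 1) * ‖v‖ := by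
  refine (pi_norm_le_iff_of_nonneg (by positivity)).2 fun q => ?_
  have hcard : (1 : ℝ) ≤ Fintype.card ι := by
    exact_mod_cast Fintype.card_pos_iff.2 ⟨q⟩
  have h1 : ‖u q + v q‖ ^ 2 ≤ (Fintype.card ι * ‖v‖) ^ 2 :=
    calc ‖u q + v q‖ ^ 2 ≤ ∑ q, ‖u q + v q‖ ^ 2 :=
          Finset.single_le_sum (f := fun q => ‖u q + v q‖ ^ 2) (fun _ _ => by positivity)
            (Finset.mem_univ q)
      _ ≤ ∑ q, ‖v q‖ ^ 2 := h
      _ ≤ ∑ _ : ι, ‖v‖ ^ 2 := by gcongr with q; exact norm_le_pi_norm v q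
      _ = Fintype.card ι * ‖v‖ ^ 2 := by simp
      _ ≤ _ := by
        rw [mul_pow]
        gcongr
        exact le_self_pow₀ hcard two_ne_zero
  have h2 := (sq_le_sq₀ (norm_nonneg _) (by positivity)).1 h1
  have h3 : ‖u q‖ ≤ ‖u q + v q‖ + ‖v q‖ := by simpa using norm_sub_le (u q + v q) (v q)
  linarith [norm_le_pi_norm v q]

theorem enorm_pow_le_sum_enorm_pow {ι : Type*} [Fintype ι] [Nonempty ι] (v : ι → ℂ) (k : ℕ) :
    ‖v‖ₑ ^ k ≤ ∑ q, ‖v q‖ₑ ^ k := by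
  obtain ⟨q, hq⟩ := Finite.exists_max fun q => ‖v q‖
  have h : ‖v‖ ≤ ‖v q‖ := (pi_norm_le_iff_of_nonneg (norm_nonneg _)).2 hq
  calc ‖v‖ₑ ^ k ≤ ‖v q‖ₑ ^ k := by gcongr; exact enorm_le_iff_norm_le.2 h
    _ ≤ _ := Finset.single_le_sum (f := fun q => ‖v q‖ₑ ^ k) (fun _ _ => zero_le)
      (Finset.mem_univ q)

/-! ### Diversity order of the error rates. -/

namespace OTFS

theorem hasDiversityOrder_of_bounds {p : ℝ → ℝ} {P : ℕ} {c C : ℝ} (hc : 0 < c)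
    (hlow : ∀ γ, 1 ≤ γ → c / γ ^ P ≤ p γ) (hup : ∀ γ, 1 ≤ γ → p γ ≤ C / γ ^ P) :
    HasDiversityOrder p P := by
  have hpos : ∀ γ, 1 ≤ γ → 0 < p γ := fun γ hγ => lt_of_lt_of_le (by positivity) (hlow γ hγ)
  have hC : 0 < C := by
    have := (hpos 1 le_rfl).trans_le (hup 1 le_rfl)
    simpa using this
  refine ⟨(eventually_ge_atTop 1).mono hpos, ?_⟩
  have hlim : ∀ K : ℝ, Tendsto (fun γ => (P : ℝ) - Real.log K / Real.log γ) atTop (𝓝 P) :=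
    fun K => by
      simpa using (tendsto_const_nhds (x := (P : ℝ))).sub
        (Real.tendsto_log_atTop.const_div_atTop (Real.log K))
  have hlog : ∀ K γ : ℝ, 0 < K → 1 < γ →
      -Real.log (K / γ ^ P) / Real.log γ = P - Real.log K / Real.log γ := fun K γ hK hγ => by
    have := Real.log_pos hγ
    rw [Real.log_div hK.ne' (by positivity), Real.log_pow]
    field_simp
    ring
  refine tendsto_of_tendsto_of_tendsto_of_le_of_le' (hlim C) (hlim c) ?_ ?_
  · filter_upwards [eventually_gt_atTop 1] with γ hγ
    rw [← hlog C γ hC hγ]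
    have := Real.log_pos hγ
    gcongr
    · exact hpos γ hγ.le
    · exact hup γ hγ.le
  · filter_upwards [eventually_gt_atTop 1] with γ hγ
    rw [← hlog c γ hc hγ]
    have := Real.log_pos hγ
    gcongr
    exact hlow γ hγ.le

variable {N M P : ℕ}

theorem norm_effectiveGain (T Δf : ℝ) (α β : Fin P → ℤ) (h : Fin P → ℂ) :
    ‖effectiveGain N M T Δf α β h‖ = ‖h‖ := by
  have : ∀ i, ‖effectiveGain N M T Δf α β h i‖ = ‖h i‖ := fun i => by
    rw [effectiveGain, norm_mul, Complex.norm_exp]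
    simp [-Complex.ofReal_div, -Complex.ofReal_mul]
  simp only [Pi.norm_def, nnnorm, this]

theorem effectiveGain_smul (T Δf : ℝ) (α β : Fin P → ℤ) (r : ℝ) (h : Fin P → ℂ) :
    effectiveGain N M T Δf α β (r • h) = r • effectiveGain N M T Δf α β h := by
  funext i
  simp [effectiveGain, mul_assoc]

theorem continuous_effectiveGain (T Δf : ℝ) (α β : Fin P → ℤ) :
    Continuous (effectiveGain N M T Δf α β) := by
  unfold effectiveGain
  fun_prop

variable [NeZero N] [NeZero M]

/-- For fixed noise `v` the gains lie in a ball of radius `K / κ * ‖v‖` in real dimension `2 * P`,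
of mass `O(‖v‖ ^ (2 * P))`. By scaling, the mean of this over `v` is a finite constant times `γ ^
(-P)`. -/
theorem channelLaw_gain_le_noise (N M : ℕ) [NeZero N] [NeZero M] (hP : 0 < P) {κ K : ℝ}
    (hκ : 0 < κ) (hK : 0 ≤ K) :
    ∃ C : ℝ, ∀ γ, 0 < γ →
      (channelLaw N M P γ).real {ω | κ * ‖ω.1‖ ≤ K * ‖ω.2‖} ≤ C / γ ^ P := by
  have hP' : ((P : ℝ≥0)⁻¹) ≠ 0 := inv_ne_zero (Nat.cast_ne_zero.2 hP.ne')
  obtain ⟨C, hC, hball⟩ := pi_complexGaussian_closedBall_le P hP'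
  set m := ∫⁻ z, ‖z‖ₑ ^ (2 * P) ∂complexGaussian 1 with hm
  have hm_top : m ≠ ⊤ := (lintegral_norm_pow_complexGaussian_lt_top 1 (2 * P)).ne
  set B := C * (K / κ) with hB
  have hB0 : 0 ≤ B := by positivity
  refine ⟨B ^ (2 * P) * (Fintype.card (Grid N M) * m.toReal), fun γ hγ => ?_⟩
  have hγr : γ⁻¹ = (√γ⁻¹) ^ 2 := (Real.sq_sqrt (by positivity)).symm
  refine ENNReal.toReal_le_of_le_ofReal (by positivity) ?_
  have hmeas : MeasurableSet {ω : (Fin P → ℂ) × (Grid N M → ℂ) | κ * ‖ω.1‖ ≤ K * ‖ω.2‖} :=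
    measurableSet_le (by fun_prop) (by fun_prop)
  rw [channelLaw, Measure.prod_apply_symm hmeas]
  calc _ ≤ ∫⁻ v, ENNReal.ofReal B ^ (2 * P) * ∑ q, ‖v q‖ₑ ^ (2 * P)
          ∂(Measure.pi fun _ : Grid N M => complexGaussian (Real.toNNReal γ⁻¹)) := by
        refine lintegral_mono fun v => ?_
        calc _ ≤ (Measure.pi fun _ : Fin P => complexGaussian ((P : ℝ≥0)⁻¹))
              (Metric.closedBall 0 (K / κ * ‖v‖)) := by
              refine measure_mono fun h hh => ?_
              rw [mem_closedBall_zero_iff, div_mul_eq_mul_div, le_div_iff₀ hκ, mul_comm]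
              exact hh
          _ ≤ ENNReal.ofReal (C * (K / κ * ‖v‖)) ^ (2 * P) := hball _ (by positivity)
          _ = ENNReal.ofReal B ^ (2 * P) * ‖v‖ₑ ^ (2 * P) := by
              rw [← mul_assoc, ENNReal.ofReal_mul hB0, mul_pow, ofReal_norm]
          _ ≤ _ := by gcongr; exact enorm_pow_le_sum_enorm_pow v _
    _ = ENNReal.ofReal B ^ (2 * P) *
          (Fintype.card (Grid N M) * (‖√γ⁻¹‖ₑ ^ (2 * P) * m)) := by
        rw [lintegral_const_mul _ (by fun_prop), lintegral_finsetSum _ (by fun_prop)]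
        have hq : ∀ q : Grid N M, ∫⁻ v, ‖v q‖ₑ ^ (2 * P)
            ∂(Measure.pi fun _ : Grid N M => complexGaussian (Real.toNNReal γ⁻¹)) =
            ‖√γ⁻¹‖ₑ ^ (2 * P) * m := fun q => by
          rw [hm, ← lintegral_norm_pow_complexGaussian_sq, ← hγr]
          exact (measurePreserving_eval (fun _ : Grid N M => complexGaussian (Real.toNNReal γ⁻¹))
            q).lintegral_comp (f := fun z => ‖z‖ₑ ^ (2 * P)) (by fun_prop)
        simp only [hq, Finset.sum_const, nsmul_eq_mul, Finset.card_univ]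
    _ = _ := by
        have h1 : ‖√γ⁻¹‖ₑ ^ (2 * P) = ENNReal.ofReal (1 / γ ^ P) := by
          rw [Real.enorm_of_nonneg (by positivity), ← ENNReal.ofReal_pow (by positivity), pow_mul,
            ← hγr, inv_pow, one_div]
        rw [h1]
        nth_rewrite 1 [← ENNReal.ofReal_toReal hm_top]
        rw [← ENNReal.ofReal_natCast, ← ENNReal.ofReal_pow hB0,
          ← ENNReal.ofReal_mul (by positivity), ← ENNReal.ofReal_mul (by positivity),
          ← ENNReal.ofReal_mul (by positivity)]
        congr 1
        ring

/-- A ball in the cone, shrunk by `r = γ ^ (-1/2)`, stays in the cone. Its noise factor keeps a mass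
bounded below, and its gain factor has mass at least of order `r ^ (2 * P) = γ ^ (-P)`. -/
theorem exists_le_channelLaw_of_isOpen (hP : 0 < P)
    {O : Set ((Fin P → ℂ) × (Grid N M → ℂ))} (hO : IsOpen O) (hne : O.Nonempty)
    (hscale : ∀ r : ℝ, 0 < r → ∀ ω ∈ O, r • ω ∈ O) :
    ∃ c : ℝ, 0 < c ∧ ∀ γ, 1 ≤ γ → c / γ ^ P ≤ (channelLaw N M P γ).real O := by
  have hP' : ((P : ℝ≥0)⁻¹) ≠ 0 := inv_ne_zero (Nat.cast_ne_zero.2 hP.ne')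
  obtain ⟨⟨h₀, w₀⟩, hmem⟩ := hne
  obtain ⟨ε, hε, hball⟩ := Metric.isOpen_iff.1 hO _ hmem
  obtain ⟨c₁, hc₁, h₁⟩ := le_pi_complexGaussian_ball hP' h₀ hε
  obtain ⟨c₂, hc₂, h₂⟩ := le_pi_complexGaussian_sq_ball w₀ hε
  refine ⟨c₁ * c₂, mul_pos hc₁ hc₂, fun γ hγ => ?_⟩
  have hγ0 : 0 < γ := one_pos.trans_le hγ
  set r := √γ⁻¹ with hr
  have hγr : γ⁻¹ = r ^ 2 := (Real.sq_sqrt (by positivity)).symm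
  have hr0 : 0 < r := Real.sqrt_pos.2 (by positivity)
  have hr1 : r ≤ 1 := Real.sqrt_le_one.2 (inv_le_one_of_one_le₀ hγ)
  refine (ENNReal.ofReal_le_iff_le_toReal (measure_ne_top _ _)).1 ?_
  calc ENNReal.ofReal (c₁ * c₂ / γ ^ P)
      = ENNReal.ofReal (c₁ * r ^ (2 * P)) * ENNReal.ofReal c₂ := by
        rw [← ENNReal.ofReal_mul (by positivity), pow_mul, ← hγr, inv_pow]
        congr 1
        ring
    _ ≤ _ := mul_le_mul' (h₁ r hr0 hr1) (h₂ r hr0)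
    _ = channelLaw N M P γ
          (Metric.ball (r • h₀) (r * ε) ×ˢ Metric.ball (r • w₀) (r * ε)) := by
        rw [channelLaw, Measure.prod_prod, hγr]
    _ ≤ _ := by
        refine measure_mono ?_
        have hsmul := smul_ball hr0.ne' (h₀, w₀) ε
        rw [Real.norm_of_nonneg hr0.le] at hsmul
        rw [ball_prod_same, ← Prod.smul_mk, ← hsmul]
        rintro _ ⟨ω, hω, rfl⟩
        exact hscale r hr0 ω (hball hω)

variable {α β : Fin P → ℤ} {a : Grid N M → ℝ} {A : Finset ℂ}

theorem received_sub (x x' : Grid N M → A) (g : Fin P → ℂ) (v : Grid N M → ℂ) (q : Grid N M) :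
    received α β a x g v q - (g ᵥ* symbolMatrix α β (rotate a x')) q =
      (g ᵥ* diffMatrix α β a x x') q + v q := by
  simp only [received, diffMatrix, Matrix.vecMul_sub, Pi.add_apply, Pi.sub_apply]
  ring

theorem diffMatrix_self (x : Grid N M → A) : diffMatrix α β a x x = 0 :=
  sub_self _

theorem exists_uniform_norm_le_norm_vecMul
    (hD : ∀ x x' : Grid N M → A, x ≠ x' → LinearIndependent ℂ (diffMatrix α β a x x').row) :
    ∃ κ : ℝ, 0 < κ ∧ ∀ x x' : Grid N M → A, x ≠ x' → ∀ h,
      κ * ‖h‖ ≤ ‖h ᵥ* diffMatrix α β a x x'‖ := by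
  choose κ hκ h using fun p : {p : (Grid N M → A) × (Grid N M → A) // p.1 ≠ p.2} =>
    exists_norm_le_norm_vecMul (hD p.1.1 p.1.2 p.2)
  rcases isEmpty_or_nonempty {p : (Grid N M → A) × (Grid N M → A) // p.1 ≠ p.2} with he | he
  · exact ⟨1, one_pos, fun x x' hx => (he.false ⟨(x, x'), hx⟩).elim⟩
  · obtain ⟨p, hp⟩ := Finite.exists_min κ
    refine ⟨κ p, hκ p, fun x x' hx g => ?_⟩
    exact (mul_le_mul_of_nonneg_right (hp ⟨(x, x'), hx⟩) (norm_nonneg g)).trans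
      (h ⟨(x, x'), hx⟩ g)

variable {dec : (Fin P → ℂ) → (Grid N M → ℂ) → (Grid N M → A)}

/-- Because `κ` is uniform, every wrong decision lies in the single event of
`channelLaw_gain_le_noise`, and no union bound over competitors is needed. -/
theorem exists_errorProb_le (hP : 0 < P) (T Δf : ℝ)
    (hD : ∀ x x' : Grid N M → A, x ≠ x' → LinearIndependent ℂ (diffMatrix α β a x x').row)
    (hdec : IsMLDetector α β a dec) :
    ∃ C : ℝ, ∀ γ, 0 < γ → ∀ x : Grid N M → A,
      (channelLaw N M P γ).real {ω | decision T Δf α β a dec x ω ≠ x} ≤ C / γ ^ P := by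
  obtain ⟨κ, hκ, hle⟩ := exists_uniform_norm_le_norm_vecMul hD
  obtain ⟨C, hC⟩ := channelLaw_gain_le_noise N M hP hκ
    (by positivity : (0 : ℝ) ≤ Fintype.card (Grid N M) + 1)
  refine ⟨C, fun γ hγ x => (measureReal_mono fun ω hω => ?_).trans (hC γ hγ)⟩
  have hmin := hdec.isMin (effectiveGain N M T Δf α β ω.1)
    (received α β a x (effectiveGain N M T Δf α β ω.1) ω.2) x
  simp only [received_sub, diffMatrix_self, Matrix.vecMul_zero, Pi.zero_apply, zero_add] at hmin
  have h := (hle _ _ (Ne.symm hω) _).trans (norm_le_of_sum_norm_add_sq_le hmin)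
  rwa [norm_effectiveGain] at h

theorem exists_le_errorProb (hP : 0 < P) (T Δf : ℝ) (hdec : IsMLDetector α β a dec)
    {x x' : Grid N M → A} (hD : LinearIndependent ℂ (diffMatrix α β a x x').row) :
    ∃ c : ℝ, 0 < c ∧ ∀ γ, 1 ≤ γ →
      c / γ ^ P ≤ (channelLaw N M P γ).real {ω | decision T Δf α β a dec x ω ≠ x} := by
  set u : (Fin P → ℂ) → Grid N M → ℂ := fun h =>
    effectiveGain N M T Δf α β h ᵥ* diffMatrix α β a x x' with hu
  have hu_cont : Continuous u := (continuous_effectiveGain T Δf α β).matrix_vecMul continuous_const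
  have hu_smul : ∀ (r : ℝ) h, u (r • h) = r • u h := fun r h => by
    simp only [hu, effectiveGain_smul, Matrix.smul_vecMul]
  -- Here `x'` is strictly closer than `x` to the received vector. Strictness makes the set open and
  -- forces an error however ties are broken.
  set O : Set ((Fin P → ℂ) × (Grid N M → ℂ)) :=
    {ω | ∑ q, ‖u ω.1 q + ω.2 q‖ ^ 2 < ∑ q, ‖ω.2 q‖ ^ 2} with hOdef
  have hO : IsOpen O := isOpen_lt (by fun_prop) (by fun_prop)
  have hne : O.Nonempty := by
    obtain ⟨κ, hκ, hle⟩ := exists_norm_le_norm_vecMul hD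
    have : Nonempty (Fin P) := ⟨⟨0, hP⟩⟩
    have hu1 : u 1 ≠ 0 := fun h => by
      have := hle (effectiveGain N M T Δf α β 1)
      rw [norm_effectiveGain, norm_one, mul_one, show _ ᵥ* _ = (0 : Grid N M → ℂ) from h,
        norm_zero] at this
      exact absurd this (not_le.2 hκ)
    obtain ⟨q, hq⟩ := Function.ne_iff.1 hu1
    -- With this noise the received vector is exactly the noiseless output of `x'`.
    refine ⟨(1, -u 1), ?_⟩
    simp only [hOdef, Set.mem_ofPred_eq, Pi.neg_apply, add_neg_cancel, norm_zero, norm_neg]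
    refine lt_of_eq_of_lt (by simp) (Finset.sum_pos' (f := fun q => ‖u 1 q‖ ^ 2)
      (fun _ _ => by positivity) ⟨q, Finset.mem_univ q, pow_pos (norm_pos_iff.2 hq) 2⟩)
  have hscale : ∀ r : ℝ, 0 < r → ∀ ω ∈ O, r • ω ∈ O := fun r hr ω hω => by
    simp only [hOdef, Set.mem_ofPred_eq, Prod.smul_fst, Prod.smul_snd, hu_smul, Pi.smul_apply,
      ← smul_add, norm_smul, mul_pow, ← Finset.mul_sum] at hω ⊢
    exact mul_lt_mul_of_pos_left hω (pow_pos (norm_pos_iff.2 hr.ne') 2)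
  obtain ⟨c, hc, h⟩ := exists_le_channelLaw_of_isOpen hP hO hne hscale
  refine ⟨c, hc, fun γ hγ => (h γ hγ).trans (measureReal_mono fun ω hω hx => ?_)⟩
  have hmin := hdec.isMin (effectiveGain N M T Δf α β ω.1)
    (received α β a x (effectiveGain N M T Δf α β ω.1) ω.2) x'
  rw [decision] at hx
  rw [hx] at hmin
  simp only [received_sub, diffMatrix_self, Matrix.vecMul_zero, Pi.zero_apply, zero_add] at hmin
  exact absurd hω (not_lt.2 hmin)

theorem bitErrorRate_le_vectorErrorProb (T Δf : ℝ) {b : ℕ} (label : A → Fin b → Bool) (γ : ℝ) :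
    bitErrorRate T Δf α β a dec label γ ≤ vectorErrorProb T Δf α β a dec γ := by
  rw [bitErrorRate, vectorErrorProb]
  refine div_le_of_le_mul₀ (by positivity)
    (div_nonneg (Finset.sum_nonneg fun _ _ => measureReal_nonneg) (by positivity)) ?_
  rcases isEmpty_or_nonempty (Grid N M → A) with he | he
  · simp
  have hcard : (Fintype.card (Grid N M → A) : ℝ) ≠ 0 := Nat.cast_ne_zero.2 Fintype.card_ne_zero
  rw [← mul_assoc, div_mul_cancel₀ _ hcard, Finset.sum_mul]
  refine Finset.sum_le_sum fun x _ => ?_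
  calc _ ≤ ∑ _ : Grid N M, ∑ _ : Fin b,
          (channelLaw N M P γ).real {ω | decision T Δf α β a dec x ω ≠ x} := by
        refine Finset.sum_le_sum fun q _ => Finset.sum_le_sum fun t _ =>
          measureReal_mono fun ω hω hx => hω ?_
        rw [hx]
    _ = _ := by
        simp [ZMod.card]
        ring

/-- By injectivity of the labelling a wrong vector has a wrong bit; a union bound over the `M * N *
b` bits follows. -/
theorem vectorErrorProb_le_mul_bitErrorRate (T Δf : ℝ) {b : ℕ} (hb : 0 < b)
    {label : A → Fin b → Bool} (hlabel : Function.Injective label) (γ : ℝ) :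
    vectorErrorProb T Δf α β a dec γ ≤ (M * N * b) * bitErrorRate T Δf α β a dec label γ := by
  have hMNb : (M * N * b : ℝ) ≠ 0 := by
    have := NeZero.ne N
    have := NeZero.ne M
    positivity
  rw [bitErrorRate, vectorErrorProb, mul_div_assoc', mul_comm (Fintype.card _ : ℝ),
    mul_div_mul_left _ _ hMNb]
  gcongr with x
  calc _ ≤ (channelLaw N M P γ).real (⋃ q : Grid N M, ⋃ t : Fin b,
          {ω | label (decision T Δf α β a dec x ω q) t ≠ label (x q) t}) := by
        refine measureReal_mono fun ω hω => ?_
        obtain ⟨q, hq⟩ := Function.ne_iff.1 hω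
        obtain ⟨t, ht⟩ := Function.ne_iff.1 (hlabel.ne hq)
        exact Set.mem_iUnion₂.2 ⟨q, t, ht⟩
    _ ≤ _ := (measureReal_iUnion_fintype_le _).trans
        (Finset.sum_le_sum fun q _ => measureReal_iUnion_fintype_le _)

end OTFS

theorem theorem1 (N M P : ℕ) [NeZero N] [NeZero M] (hP : 0 < P)
    (T Δf : ℝ) (hT : 0 < T) (hΔf : 0 < Δf)
    (α β : Fin P → ℤ)
    (hpaths : Function.Injective fun i => ((β i : ZMod N), (α i : ZMod M)))
    (A : Finset ℂ) (hA : 2 ≤ A.card)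
    (hAalg : ∀ s ∈ A, ∀ s' ∈ A, IsAlgebraic ℚ (s - s'))
    (a : OTFS.Grid N M → ℝ) (ha_inj : Function.Injective a)
    (ha_alg : ∀ q, IsAlgebraic ℚ (a q)) :
    (∀ x₁ x₂ : OTFS.Grid N M → A, x₁ ≠ x₂ → (OTFS.diffMatrix α β a x₁ x₂).rank = P) ∧
    IsLeast {r : ℕ | ∃ x₁ x₂ : OTFS.Grid N M → A, x₁ ≠ x₂ ∧
      r = (OTFS.diffMatrix α β a x₁ x₂).rank} P ∧
    ∀ dec : (Fin P → ℂ) → (OTFS.Grid N M → ℂ) → (OTFS.Grid N M → A),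
      OTFS.IsMLDetector α β a dec →
        OTFS.HasDiversityOrder (OTFS.vectorErrorProb T Δf α β a dec) P ∧
        ∀ (b : ℕ) (label : A → Fin b → Bool), Function.Injective label →
          OTFS.HasDiversityOrder (OTFS.bitErrorRate T Δf α β a dec label) P := by
  have hind := OTFS.linearIndependent_diffMatrix α β hpaths A hAalg a ha_inj ha_alg
  have hrank := OTFS.rank_diffMatrix α β hpaths A hAalg a ha_inj ha_alg
  have : Nontrivial A := Fintype.one_lt_card_iff_nontrivial.1 (by rwa [Fintype.card_coe])
  obtain ⟨x₀, x₁, hx⟩ := exists_pair_ne (OTFS.Grid N M → A)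
  refine ⟨hrank, ⟨⟨x₀, x₁, hx, (hrank _ _ hx).symm⟩, ?_⟩, fun dec hdec => ?_⟩
  · rintro _ ⟨y₀, y₁, hy, rfl⟩
    exact (hrank _ _ hy).ge
  have hcard : (0 : ℝ) < Fintype.card (OTFS.Grid N M → A) := Nat.cast_pos.2 Fintype.card_pos
  obtain ⟨C, hC⟩ := OTFS.exists_errorProb_le hP T Δf hind hdec
  obtain ⟨c, hc, hlow⟩ := OTFS.exists_le_errorProb hP T Δf hdec (hind _ _ hx)
  have hup_vec : ∀ γ, 1 ≤ γ → OTFS.vectorErrorProb T Δf α β a dec γ ≤ C / γ ^ P := fun γ hγ => by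
    rw [OTFS.vectorErrorProb, div_le_iff₀ hcard]
    refine (Finset.sum_le_sum fun x _ => hC γ (one_pos.trans_le hγ) x).trans (le_of_eq ?_)
    rw [Finset.sum_const, nsmul_eq_mul, Finset.card_univ, mul_comm]
  have hlow_vec : ∀ γ, 1 ≤ γ → c / Fintype.card (OTFS.Grid N M → A) / γ ^ P ≤
      OTFS.vectorErrorProb T Δf α β a dec γ := fun γ hγ => by
    rw [OTFS.vectorErrorProb, div_right_comm]
    gcongr
    exact (hlow γ hγ).trans (Finset.single_le_sum (f := fun x =>
      (OTFS.channelLaw N M P γ).real {ω | OTFS.decision T Δf α β a dec x ω ≠ x})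
      (fun _ _ => measureReal_nonneg) (Finset.mem_univ x₀))
  refine ⟨OTFS.hasDiversityOrder_of_bounds (by positivity) hlow_vec hup_vec,
    fun b label hlabel => ?_⟩
  -- With no bits, an injective labelling would leave at most one symbol.
  have hb : 0 < b := by
    rw [Nat.pos_iff_ne_zero]
    rintro rfl
    exact not_subsingleton A hlabel.subsingleton
  have hMNb : (0 : ℝ) < M * N * b := by
    have := NeZero.ne N
    have := NeZero.ne M
    positivity
  refine OTFS.hasDiversityOrder_of_bounds
    (c := c / Fintype.card (OTFS.Grid N M → A) / (M * N * b)) (by positivity) (fun γ hγ => ?_)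
    fun γ hγ => (OTFS.bitErrorRate_le_vectorErrorProb T Δf label γ).trans (hup_vec γ hγ)
  rw [div_right_comm, div_le_iff₀' hMNb]
  exact (hlow_vec γ hγ).trans (OTFS.vectorErrorProb_le_mul_bitErrorRate T Δf hb hlabel γ)
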